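/- There is an absolute constant $C>0$ such that, with $\epsilon(k,m):=C\sqrt{k\log m/m}$, the following holds for all integers $k\ge 1$ and $m\ge 2$. Let $c_1,\dots,c_k\in\mathbb R^m$ and, for each $i\in[k]$, let $\mu_i$ be a (Borel) probability measure on the closed Euclidean unit ball $B_1^m(c_i)$ such that - (a1) $\mu_i$ is invariant under rotations centered in $c_i$; - (a2) every open subset of $B_1^m(c_i)$ containing $c_i$ has positive $\mu_i$-measure; - (a3) every subset of $B_1^m(c_i)$ of zero Lebesgue measure has zero $\mu_i$-measure. Let $E_i:=\int d(x,c_i)\,d\mu_i(x)$, where $d$ is the Euclidean distance, and assume $E_1=\dots=E_k$. For each $n$, draw independently $n$ points from each $\mu_i$, $i\in[k]$, and let $P$ be the resulting family of $kn$ points. Consider the linear program \[ \begin{aligned} \min\ & \sum_{p,q\in P} d(p,q)\,z_{pq}\\ \text{s.t.}\ & \sum_{p\in P} z_{pq}=1 \quad \forall q\in P,\\ & z_{pq}\le y_p \quad \forall p,q\in P,\\ & \sum_{p\in P} y_p=k,\\ & y_p,\,z_{pq}\ge 0\quad \forall p,q\in P, \end{aligned} \tag{LP} \] and let (IP) be the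 integer program obtained by replacing $y_p,z_{pq}\ge 0$ with $y_p,z_{pq}\in\{0,1\}$. If \[ d(c_i,c_j)>2+\epsilon(k,m)\qquad\text{for all } i\neq j, \] then (LP) achieves exact recovery with high probability. That is, for every $\delta\in(0,1)$ there is $N$ such that for all $n>N$, with probability greater than $1-\delta$, (LP) has a unique optimal solution, this solution is feasible for (IP), and it assigns each point to the ball from which it is drawn (if $z_{pq}=1$ then $p$ and $q$ were drawn from the same ball). -/

import Mathlib

open MeasureTheory

namespace KMedian

/-! ### The linear program for the `k`-median problem -/

section LP

variable {ι E : Type*} [Fintype ι] [MetricSpace E]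

/-- Feasibility of `s = (y, z)` for the linear programming relaxation of the `k`-median problem
on a point family indexed by `ι`; `s.1 p` is `y_p` and `s.2 p q` is `z_{pq}`. -/
structure LPFeasible (k : ℕ) (s : (ι → ℝ) × (ι → ι → ℝ)) : Prop where
  assign : ∀ q, ∑ p, s.2 p q = 1
  le_open : ∀ p q, s.2 p q ≤ s.1 p
  card : ∑ p, s.1 p = k
  y_nonneg : ∀ p, 0 ≤ s.1 p
  z_nonneg : ∀ p q, 0 ≤ s.2 p q

/-- Feasibility for the integer program: additionally all variables lie in `{0, 1}`. -/
structure IPFeasible (k : ℕ) (s : (ι → ℝ) × (ι → ι → ℝ)) : Prop where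
  assign : ∀ q, ∑ p, s.2 p q = 1
  le_open : ∀ p q, s.2 p q ≤ s.1 p
  card : ∑ p, s.1 p = k
  y_binary : ∀ p, s.1 p = 0 ∨ s.1 p = 1
  z_binary : ∀ p q, s.2 p q = 0 ∨ s.2 p q = 1

/-- The objective `∑_{p,q} d(p,q) z_{pq}`. -/
def cost (x : ι → E) (s : (ι → ℝ) × (ι → ι → ℝ)) : ℝ :=
  ∑ p, ∑ q, dist (x p) (x q) * s.2 p q

/-- `s` is an optimal solution of the linear program for the points `x`. -/
def LPOptimal (k : ℕ) (x : ι → E) (s : (ι → ℝ) × (ι → ι → ℝ)) : Prop :=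
  LPFeasible k s ∧ ∀ s', LPFeasible k s' → cost x s ≤ cost x s'

/-- Exact recovery: the linear program has a unique optimal solution, this solution is feasible
for the integer program, and it assigns each point `q` to (a center in) the ball from which `q`
was drawn, `label p` being the ball from which the point with index `p` was drawn. -/
def ExactRecovery {κ : Type*} (k : ℕ) (label : ι → κ) (x : ι → E) : Prop :=
  ∃ s, LPOptimal k x s ∧ (∀ s', LPOptimal k x s' → s' = s) ∧ IPFeasible k s ∧
    ∀ p q, s.2 p q = 1 → label p = label q

end LP

/-! ### Probability measures on balls -/

section Measures

variable {m : ℕ}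

/-- `μ` is a probability measure on the closed ball of radius `r` centered at `c`. -/
def IsProbabilityOnBall (μ : Measure (EuclideanSpace ℝ (Fin m))) (c : EuclideanSpace ℝ (Fin m))
    (r : ℝ) : Prop :=
  IsProbabilityMeasure μ ∧ μ (Metric.closedBall c r)ᶜ = 0

/-- `μ` is invariant under every rotation centered in `c`
(every orientation preserving linear isometry, conjugated by the translation by `c`). -/
def RotationInvariant (μ : Measure (EuclideanSpace ℝ (Fin m))) (c : EuclideanSpace ℝ (Fin m)) :
    Prop :=
  ∀ g : EuclideanSpace ℝ (Fin m) ≃ₗᵢ[ℝ] EuclideanSpace ℝ (Fin m),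
    LinearMap.det (g.toLinearEquiv : EuclideanSpace ℝ (Fin m) →ₗ[ℝ] EuclideanSpace ℝ (Fin m)) = 1 →
      μ.map (fun x => c + g (x - c)) = μ

/-- Every open subset of the ball containing the center has positive measure. -/
def PositiveNearCenter (μ : Measure (EuclideanSpace ℝ (Fin m))) (c : EuclideanSpace ℝ (Fin m))
    (r : ℝ) : Prop :=
  ∀ U : Set (EuclideanSpace ℝ (Fin m)), IsOpen U → U ⊆ Metric.closedBall c r → c ∈ U → 0 < μ U

/-- Every subset of the ball with zero Lebesgue measure has zero `μ`-measure. -/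
def NullOnLebesgueNull (μ : Measure (EuclideanSpace ℝ (Fin m))) (c : EuclideanSpace ℝ (Fin m))
    (r : ℝ) : Prop :=
  ∀ S : Set (EuclideanSpace ℝ (Fin m)), S ⊆ Metric.closedBall c r → volume S = 0 → μ S = 0

/-- The joint law of the data when `n` points are drawn from each of the `k` balls, all
independently, the points `(i, 1), …, (i, n)` having law `μ i`. -/
noncomputable def sampleLaw {k : ℕ} (n : ℕ) (μ : Fin k → Measure (EuclideanSpace ℝ (Fin m))) :
    Measure (Fin k × Fin n → EuclideanSpace ℝ (Fin m)) :=
  Measure.pi fun p => μ p.1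

end Measures

/-- The events `A n` happen with high probability: for every `δ ∈ (0, 1)` there is `N` such that
`Pr (A n) > 1 - δ` for all `n > N`. The measurable `B ⊆ A n` makes this the inner probability,
so that no outer measure of a possibly nonmeasurable set enters;
for a measurable `A n` it is the usual condition. -/
def WithHighProbability {Ω : ℕ → Type*} [∀ n, MeasurableSpace (Ω n)] (P : ∀ n, Measure (Ω n))
    (A : ∀ n, Set (Ω n)) : Prop :=
  ∀ δ : ℝ, 0 < δ → δ < 1 → ∃ N : ℕ, ∀ n : ℕ, N < n →
    ∃ B : Set (Ω n), MeasurableSet B ∧ B ⊆ A n ∧ ENNReal.ofReal (1 - δ) < P n B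

end KMedian

/-!
The proof is by linear programming duality. The dual of the relaxation asks for numbers `α q` and
`ω` with `∑ q, max (α q - d(p, q)) 0 ≤ ω` for every point `p`, and its value is `∑ α q - k ω`.
If equality holds at one point `med i` of every ball and nowhere else, and `α q` separates the
distances of `q` to its own `med i` and to the others, complementary slackness forces every optimal
solution to be the one opening the points `med i` (`exactRecovery_of_certificate`).

Take `med i` to be the sample median of the ball `i`, and `α q` constant on every ball, equal to a
common value `α = 1 + e / 2`, where `2 + e` bounds the separation from below, up to a correction
that equalizes the sample median costs; the correction tends to `0` because all `E_i` agree. For a point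
near a center the hinge `max (α q - d(p, q)) 0` is active exactly on its own ball, so the certificate says
that `med i` is the strict sample median. Ties between medians are null events, since the level
sets of a sum of distances lie in frontiers of convex sets (`volume_level_set_sum_dist`).

For a point `p` away from the centers, one needs that the expected slack
`∑ j, E_{μ j} max (α - d(p, x)) 0` falls below its value `α - E` at the centers by a fixed margin;
the weak law of large numbers and a finite net carry this over to the sample
(`withHighProbability_of_slack`). If `e ≤ 2`, the margin rests on one fact:
the direction of a rotation invariant vector has second moment at most `‖u‖ ^ 2 / m` along `u`
(`RotationInvariant.integral_dirInner_sq_le`). In the own ball the slack drops by an amount of order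
`e ^ 2`, up to an error of order `1 / m`, while each of the other balls contributes at most `9 / m`;
since `e ^ 2` is a large multiple of `k log m / m`, the loss wins (`exists_slack_of_high_dim`).
If `e > 2`, the dimension may be small. Then `α = 2` works: the hinge does not
truncate distances inside a ball and vanishes on the others, and the margin comes from the center
being the unique median of `μ i` (`exists_slack_of_far_apart`).
-/

namespace KMedian

/-! ### A dual certificate for the linear program -/

section Certificate

variable {ι E : Type*} [Fintype ι] [MetricSpace E]

/-- The solution of the integer program that opens the points `med i` and assigns every point `q`
to the point `med (label q)`. -/
noncomputable def medianSolution {κ : Type*} (label : ι → κ) (med : κ → ι) :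
    (ι → ℝ) × (ι → ι → ℝ) := by
  classical
  exact (fun p => if p = med (label p) then 1 else 0, fun p q => if p = med (label q) then 1 else 0)

/-- The duality gap between the cost of `s` and the dual value `∑ α q - k ω`. If
`∑ q, max (α q - d(p, q)) 0 ≤ ω` for all `p`, its three parts are nonnegative, and their vanishing
is complementary slackness. -/
lemma LPFeasible.cost_eq {k : ℕ} {s : (ι → ℝ) × (ι → ι → ℝ)} (hs : LPFeasible k s) (x : ι → E)
    (α : ι → ℝ) (ω : ℝ) :
    cost x s = (∑ q, α q - k * ω)
      + ∑ p, ∑ q, (max (α q - dist (x p) (x q)) 0 - (α q - dist (x p) (x q))) * s.2 p q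
      + ∑ p, ∑ q, max (α q - dist (x p) (x q)) 0 * (s.1 p - s.2 p q)
      + ∑ p, (ω - ∑ q, max (α q - dist (x p) (x q)) 0) * s.1 p := by
  have h1 : ∑ q, α q = ∑ p, ∑ q, α q * s.2 p q := by
    rw [Finset.sum_comm]
    refine Finset.sum_congr rfl fun q _ => ?_
    rw [← Finset.mul_sum, hs.assign q, mul_one]
  have h2 : (k : ℝ) * ω = ∑ p, ω * s.1 p := by
    rw [← Finset.mul_sum, hs.card, mul_comm]
  rw [h1, h2, cost]
  simp only [← Finset.sum_add_distrib, ← Finset.sum_sub_distrib, sub_mul, Finset.sum_mul, mul_sub]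
  simp only [Finset.sum_sub_distrib, Finset.sum_add_distrib]
  ring

/-- If the dual variables `α q` and `ω` satisfy strict complementary slackness with the solution
that opens exactly one point `med i` in every class `i`, this solution is the unique optimum. -/
lemma exactRecovery_of_certificate {k : ℕ} {label : ι → Fin k} (x : ι → E)
    (med : Fin k → ι) (hmed : ∀ i, label (med i) = i) (α : ι → ℝ) (ω : ℝ)
    (hin : ∀ q, dist (x (med (label q))) (x q) ≤ α q)
    (hout : ∀ i q, label q ≠ i → α q < dist (x (med i)) (x q))
    (heq : ∀ i, ∑ q, max (α q - dist (x (med i)) (x q)) 0 = ω)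
    (hlt : ∀ p, (∀ i, p ≠ med i) → ∑ q, max (α q - dist (x p) (x q)) 0 < ω) :
    ExactRecovery k label x := by
  classical
  have hinj : Function.Injective med := fun i j h => by rw [← hmed i, ← hmed j, h]
  have hle : ∀ p, ∑ q, max (α q - dist (x p) (x q)) 0 ≤ ω := by
    intro p
    by_cases h : ∀ i, p ≠ med i
    · exact (hlt p h).le
    · push Not at h
      obtain ⟨i, rfl⟩ := h
      exact (heq i).le
  set s₀ := medianSolution label med with hs₀
  have hz : ∀ p q, s₀.2 p q = if p = med (label q) then 1 else 0 := fun p q => rfl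
  have hy : ∀ p, s₀.1 p = if p = med (label p) then 1 else 0 := fun p => rfl
  have hcard : ∑ p, s₀.1 p = k := by
    have : (Finset.univ.filter fun p => p = med (label p)) = Finset.univ.image med := by
      ext p
      simp only [Finset.mem_filter, Finset.mem_univ, true_and, Finset.mem_image]
      exact ⟨fun h => ⟨_, h.symm⟩, by rintro ⟨i, rfl⟩; rw [hmed]⟩
    simp only [hy, Finset.sum_boole, this, Finset.card_image_of_injective _ hinj,
      Finset.card_univ, Fintype.card_fin]
  have hIP : IPFeasible k s₀ := by
    refine ⟨fun q => by simp [hz], fun p q => ?_, hcard, fun p => ?_, fun p q => ?_⟩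
    · rw [hz, hy]
      by_cases h : p = med (label q)
      · subst h
        simp [hmed]
      · rw [if_neg h]
        split_ifs <;> norm_num
    · rw [hy]; split_ifs <;> simp
    · rw [hz]; split_ifs <;> simp
  have hLP : LPFeasible k s₀ := by
    refine ⟨hIP.assign, hIP.le_open, hIP.card, fun p => ?_, fun p q => ?_⟩
    · rcases hIP.y_binary p with h | h <;> simp [h]
    · rcases hIP.z_binary p q with h | h <;> simp [h]
  -- each of the three parts of the duality gap is nonnegative
  have hA : ∀ s : (ι → ℝ) × (ι → ι → ℝ), LPFeasible k s → ∀ p q,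
      0 ≤ (max (α q - dist (x p) (x q)) 0 - (α q - dist (x p) (x q))) * s.2 p q :=
    fun s hs p q => mul_nonneg (sub_nonneg.2 (le_max_left _ _)) (hs.z_nonneg p q)
  have hB : ∀ s : (ι → ℝ) × (ι → ι → ℝ), LPFeasible k s → ∀ p q,
      0 ≤ max (α q - dist (x p) (x q)) 0 * (s.1 p - s.2 p q) :=
    fun s hs p q => mul_nonneg (le_max_right _ _) (sub_nonneg.2 (hs.le_open p q))
  have hC : ∀ s : (ι → ℝ) × (ι → ι → ℝ), LPFeasible k s → ∀ p,
      0 ≤ (ω - ∑ q, max (α q - dist (x p) (x q)) 0) * s.1 p :=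
    fun s hs p => mul_nonneg (sub_nonneg.2 (hle p)) (hs.y_nonneg p)
  have hcost₀ : cost x s₀ = ∑ q, α q - k * ω := by
    rw [hLP.cost_eq x α ω]
    have h1 : ∀ p q, (max (α q - dist (x p) (x q)) 0 - (α q - dist (x p) (x q))) * s₀.2 p q
        = 0 := by
      intro p q
      rw [hz]
      split_ifs with h
      · rw [h, max_eq_left (sub_nonneg.2 (hin q))]; ring
      · ring
    have h2 : ∀ p q, max (α q - dist (x p) (x q)) 0 * (s₀.1 p - s₀.2 p q) = 0 := by
      intro p q
      rw [hz, hy]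
      by_cases hp : p = med (label p)
      · by_cases hq : label q = label p
        · rw [hq]; ring
        · have := hout (label p) q hq
          rw [← hp] at this
          rw [max_eq_right (by linarith)]; ring
      · have : p ≠ med (label q) := fun h => hp (by rw [h, hmed])
        rw [if_neg hp, if_neg this]; ring
    have h3 : ∀ p, (ω - ∑ q, max (α q - dist (x p) (x q)) 0) * s₀.1 p = 0 := by
      intro p
      rw [hy]
      split_ifs with h
      · rw [h, heq]; ring
      · ring
    simp only [h1, h2, h3, Finset.sum_const_zero, add_zero]
  refine ⟨s₀, ⟨hLP, fun s hs => ?_⟩, fun s hs => ?_, hIP, fun p q hpq => ?_⟩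
  · rw [hcost₀, hs.cost_eq x α ω]
    have h1 := Finset.sum_nonneg fun p (_ : p ∈ Finset.univ) =>
      Finset.sum_nonneg fun q (_ : q ∈ Finset.univ) => hA s hs p q
    have h2 := Finset.sum_nonneg fun p (_ : p ∈ Finset.univ) =>
      Finset.sum_nonneg fun q (_ : q ∈ Finset.univ) => hB s hs p q
    have h3 := Finset.sum_nonneg fun p (_ : p ∈ Finset.univ) => hC s hs p
    linarith
  · obtain ⟨hs, hopt⟩ := hs
    have h0 := hopt s₀ hLP
    rw [hcost₀, hs.cost_eq x α ω] at h0
    have h1' : ∀ p ∈ Finset.univ, 0 ≤ ∑ q,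
        (max (α q - dist (x p) (x q)) 0 - (α q - dist (x p) (x q))) * s.2 p q := fun p _ =>
      Finset.sum_nonneg fun q _ => hA s hs p q
    have h1 := Finset.sum_nonneg h1'
    have h2 := Finset.sum_nonneg fun p (_ : p ∈ Finset.univ) =>
      Finset.sum_nonneg fun q (_ : q ∈ Finset.univ) => hB s hs p q
    have h3 := Finset.sum_nonneg fun p (_ : p ∈ Finset.univ) => hC s hs p
    have e1 := (Finset.sum_eq_zero_iff_of_nonneg h1').1 (by linarith)
    have e3 := (Finset.sum_eq_zero_iff_of_nonneg fun p (_ : p ∈ Finset.univ) => hC s hs p).1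
      (by linarith)
    have hy0 : ∀ p, (∀ i, p ≠ med i) → s.1 p = 0 := fun p hp =>
      (mul_eq_zero.1 (e3 p (Finset.mem_univ p))).resolve_left (sub_pos.2 (hlt p hp)).ne'
    have hz0 : ∀ p q, p ≠ med (label q) → s.2 p q = 0 := by
      intro p q hpq
      by_cases hp : ∀ i, p ≠ med i
      · exact le_antisymm ((hs.le_open p q).trans (hy0 p hp).le) (hs.z_nonneg p q)
      · push Not at hp
        obtain ⟨i, rfl⟩ := hp
        have hne : label q ≠ i := fun h => hpq (by rw [h])
        have h := (Finset.sum_eq_zero_iff_of_nonneg fun q _ => hA s hs (med i) q).1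
          (e1 (med i) (Finset.mem_univ _)) q (Finset.mem_univ _)
        refine (mul_eq_zero.1 h).resolve_left ?_
        have := hout i q hne
        rw [max_eq_right (by linarith)]
        linarith
    have hz1 : ∀ q, s.2 (med (label q)) q = 1 := by
      intro q
      rw [← hs.assign q]
      exact (Finset.sum_eq_single _ (fun p _ hp => hz0 p q hp)
        fun h => absurd (Finset.mem_univ _) h).symm
    have hzeq : s.2 = s₀.2 := by
      ext p q
      rw [hz]
      split_ifs with h
      · rw [h, hz1]
      · exact hz0 p q h
    -- the open mass at every median is at least `1`, and the total is `k`
    have hyle : ∀ p ∈ Finset.univ, s₀.1 p ≤ s.1 p := by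
      intro p _
      rw [hy]
      split_ifs with h
      · rw [← hz1 p, ← h]; exact hs.le_open p p
      · exact hs.y_nonneg p
    have hyeq := (Finset.sum_eq_sum_iff_of_le hyle).1 (hcard.trans hs.card.symm)
    exact Prod.ext (funext fun p => (hyeq p (Finset.mem_univ p)).symm) hzeq
  · rw [hz] at hpq
    split_ifs at hpq with h
    · rw [h, hmed]
    · norm_num at hpq

end Certificate

/-! ### Moments of the direction of a rotation invariant random vector -/

section Moments

open scoped RealInnerProductSpace

/-- The product of the reflections in `(v - w)ᗮ` and `wᗮ` is a rotation taking a unit vector `v` to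
the negative of another one. -/
lemma exists_rotation_apply_eq_neg {F : Type*} [NormedAddCommGroup F] [InnerProductSpace ℝ F]
    [FiniteDimensional ℝ F] {v w : F} (hv : ‖v‖ = 1) (hw : ‖w‖ = 1) (hvw : v ≠ w) :
    ∃ g : F ≃ₗᵢ[ℝ] F, LinearMap.det (g.toLinearEquiv : F →ₗ[ℝ] F) = 1 ∧ g v = -w := by
  have hdet : ∀ a : F, a ≠ 0 →
      LinearMap.det ((ℝ ∙ a)ᗮ.reflection.toLinearEquiv : F →ₗ[ℝ] F) = -1 := by
    intro a ha
    have := (ℝ ∙ a)ᗮ.det_reflection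
    rw [Submodule.orthogonal_orthogonal, finrank_span_singleton ha, pow_one] at this
    exact this
  refine ⟨(ℝ ∙ (v - w))ᗮ.reflection.trans (ℝ ∙ w)ᗮ.reflection, ?_, ?_⟩
  · have h1 := hdet (v - w) (sub_ne_zero.2 hvw)
    have h2 := hdet w (by rintro rfl; simp at hw)
    have : (((ℝ ∙ (v - w))ᗮ.reflection.trans (ℝ ∙ w)ᗮ.reflection).toLinearEquiv : F →ₗ[ℝ] F)
        = ((ℝ ∙ w)ᗮ.reflection.toLinearEquiv : F →ₗ[ℝ] F)
          * ((ℝ ∙ (v - w))ᗮ.reflection.toLinearEquiv : F →ₗ[ℝ] F) := rfl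
    rw [this, map_mul, h1, h2]
    norm_num
  · rw [LinearIsometryEquiv.trans_apply, Submodule.reflection_sub (by rw [hv, hw]),
      Submodule.reflection_orthogonalComplement_singleton_eq_neg]

variable {m : ℕ} {μ : Measure (EuclideanSpace ℝ (Fin m))} {c : EuclideanSpace ℝ (Fin m)}

/-- The scalar product of `u` with the direction of `x`, which is `0` at `x = 0`. -/
noncomputable def dirInner (x u : EuclideanSpace ℝ (Fin m)) : ℝ := ⟪x, u⟫ / ‖x‖

lemma abs_dirInner_le (x u : EuclideanSpace ℝ (Fin m)) : |dirInner x u| ≤ ‖u‖ := by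
  rw [dirInner, abs_div, abs_norm]
  refine div_le_of_le_mul₀ (norm_nonneg _) (norm_nonneg _) ?_
  rw [mul_comm]
  exact abs_real_inner_le_norm x u

lemma dirInner_sq_le (x u : EuclideanSpace ℝ (Fin m)) : dirInner x u ^ 2 ≤ ‖u‖ ^ 2 :=
  sq_le_sq' (neg_le_of_abs_le (abs_dirInner_le x u)) (le_of_abs_le (abs_dirInner_le x u))

lemma measurable_dirInner (u c : EuclideanSpace ℝ (Fin m)) :
    Measurable fun x : EuclideanSpace ℝ (Fin m) => dirInner (x - c) u := by
  unfold dirInner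
  fun_prop

lemma integrable_dirInner [IsFiniteMeasure μ] (u c : EuclideanSpace ℝ (Fin m)) :
    Integrable (fun x => dirInner (x - c) u) μ :=
  Integrable.of_bound (measurable_dirInner u c).aestronglyMeasurable ‖u‖
    (Filter.Eventually.of_forall fun _ => abs_dirInner_le _ _)

lemma integrable_dirInner_sq [IsFiniteMeasure μ] (u c : EuclideanSpace ℝ (Fin m)) :
    Integrable (fun x => dirInner (x - c) u ^ 2) μ :=
  Integrable.of_bound ((measurable_dirInner u c).pow_const 2).aestronglyMeasurable (‖u‖ ^ 2)
    (Filter.Eventually.of_forall fun x => by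
      rw [Real.norm_eq_abs, abs_of_nonneg (sq_nonneg _)]; exact dirInner_sq_le _ _)

/-- Under a rotation invariant law, the coordinate of the direction along `v` and the negative of
the one along `w` are equally distributed, for all unit vectors `v ≠ w`. -/
lemma RotationInvariant.integral_dirInner_eq (h : RotationInvariant μ c)
    {v w : EuclideanSpace ℝ (Fin m)} (hv : ‖v‖ = 1) (hw : ‖w‖ = 1) (hvw : v ≠ w) {φ : ℝ → ℝ}
    (hφ : Measurable φ) :
    ∫ x, φ (dirInner (x - c) v) ∂μ = ∫ x, φ (-dirInner (x - c) w) ∂μ := by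
  obtain ⟨g, hg, hgv⟩ := exists_rotation_apply_eq_neg hv hw hvw
  have hmeas : Measurable fun x => c + g (x - c) := by
    have := g.continuous
    exact (by fun_prop : Continuous fun x => c + g (x - c)).measurable
  symm
  calc ∫ x, φ (-dirInner (x - c) w) ∂μ
      = ∫ x, φ (-dirInner (x - c) w) ∂(μ.map fun x => c + g (x - c)) := by rw [h g hg]
    _ = ∫ x, φ (-dirInner (c + g (x - c) - c) w) ∂μ :=
        integral_map hmeas.aemeasurable
          (hφ.comp (measurable_dirInner w c).neg).aestronglyMeasurable
    _ = ∫ x, φ (dirInner (x - c) v) ∂μ := by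
        refine integral_congr_ae (Filter.Eventually.of_forall fun x => ?_)
        have : ⟪g (x - c), w⟫ = -⟪x - c, v⟫ := by
          rw [← neg_neg w, ← hgv, inner_neg_right, g.inner_map_map]
        simp only [dirInner, add_sub_cancel_left, this, g.norm_map, neg_div, neg_neg]

lemma dirInner_smul (x u : EuclideanSpace ℝ (Fin m)) (a : ℝ) :
    dirInner x (a • u) = a * dirInner x u := by
  rw [dirInner, dirInner, real_inner_smul_right, mul_div_assoc]

lemma exists_ne_zero_inner_eq_zero (hm : 2 ≤ m) (v : EuclideanSpace ℝ (Fin m)) :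
    ∃ w : EuclideanSpace ℝ (Fin m), w ≠ 0 ∧ ⟪v, w⟫ = 0 := by
  have h : 0 < Module.finrank ℝ (ℝ ∙ v)ᗮ := by
    have h1 := (ℝ ∙ v).finrank_add_finrank_orthogonal
    have h2 : Module.finrank ℝ (ℝ ∙ v) ≤ 1 := (finrank_span_le_card {v}).trans_eq (by simp)
    rw [finrank_euclideanSpace_fin] at h1
    omega
  have := Module.finrank_pos_iff.1 h
  obtain ⟨w, hw⟩ := exists_ne (0 : (ℝ ∙ v)ᗮ)
  exact ⟨w, by simpa using hw, Submodule.mem_orthogonal_singleton_iff_inner_right.1 w.2⟩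

lemma exists_eq_smul_unit (hm : 0 < m) (u : EuclideanSpace ℝ (Fin m)) :
    ∃ v : EuclideanSpace ℝ (Fin m), ‖v‖ = 1 ∧ u = ‖u‖ • v := by
  have : Nonempty (Fin m) := ⟨⟨0, hm⟩⟩
  by_cases hu : u = 0
  · obtain ⟨v, hv⟩ := exists_norm_eq (EuclideanSpace ℝ (Fin m)) zero_le_one
    exact ⟨v, hv, by simp [hu]⟩
  · refine ⟨‖u‖⁻¹ • u, norm_smul_inv_norm hu, ?_⟩
    rw [smul_smul, mul_inv_cancel₀ (norm_ne_zero_iff.2 hu), one_smul]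

/-- The direction of a rotation invariant random vector in dimension at least `2` is centered. -/
lemma RotationInvariant.integral_dirInner (h : RotationInvariant μ c) (hm : 2 ≤ m)
    (u : EuclideanSpace ℝ (Fin m)) : ∫ x, dirInner (x - c) u ∂μ = 0 := by
  obtain ⟨v, hv, hu⟩ := exists_eq_smul_unit (by omega) u
  obtain ⟨w, hw, hwv⟩ : ∃ w : EuclideanSpace ℝ (Fin m), ‖w‖ = 1 ∧ ⟪v, w⟫ = 0 := by
    have hv0 : v ≠ 0 := by rintro rfl; simp at hv
    obtain ⟨w, hw, hw0⟩ := exists_ne_zero_inner_eq_zero hm v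
    refine ⟨‖w‖⁻¹ • w, norm_smul_inv_norm hw, ?_⟩
    rw [real_inner_smul_right, hw0, mul_zero]
  have hvv : ⟪v, v⟫ = 1 := by rw [real_inner_self_eq_norm_sq, hv, one_pow]
  have h1 : v ≠ w := by rintro rfl; linarith
  have h2 : w ≠ -v := by rintro rfl; rw [inner_neg_right] at hwv; linarith
  -- the first moments along `v`, `w`, `-v` alternate in sign
  have e1 := h.integral_dirInner_eq hv hw h1 measurable_id
  have e2 := h.integral_dirInner_eq hw (by rwa [norm_neg]) h2 measurable_id
  have e3 : ∀ x, dirInner (x - c) (-v) = -dirInner (x - c) v := fun x => by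
    rw [dirInner, inner_neg_right, neg_div, dirInner]
  simp only [id, e3, neg_neg, integral_neg] at e1 e2
  rw [hu]
  simp only [dirInner_smul, integral_const_mul]
  rw [show ∫ x, dirInner (x - c) v ∂μ = 0 by linarith, mul_zero]

/-- The direction of a rotation invariant random vector has the same second moment along every
unit vector, and these moments along an orthonormal basis sum up to at most `1`. -/
lemma RotationInvariant.integral_dirInner_sq_le [IsProbabilityMeasure μ]
    (h : RotationInvariant μ c) (hm : 0 < m) (u : EuclideanSpace ℝ (Fin m)) :
    ∫ x, dirInner (x - c) u ^ 2 ∂μ ≤ ‖u‖ ^ 2 / m := by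
  obtain ⟨v, hv, hu⟩ := exists_eq_smul_unit hm u
  set b := EuclideanSpace.basisFun (Fin m) ℝ
  have heq : ∀ i, ∫ x, dirInner (x - c) (b i) ^ 2 ∂μ = ∫ x, dirInner (x - c) v ^ 2 ∂μ := by
    intro i
    by_cases hvi : b i = v
    · rw [hvi]
    · have := h.integral_dirInner_eq (b.norm_eq_one i) hv hvi (measurable_id.pow_const 2)
      simpa only [id, neg_sq] using this
  have hsum : ∑ i, ∫ x, dirInner (x - c) (b i) ^ 2 ∂μ ≤ 1 := by
    rw [← integral_finsetSum _ fun i _ => integrable_dirInner_sq _ _]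
    have : ∀ x, ∑ i, dirInner (x - c) (b i) ^ 2 ≤ 1 := by
      intro x
      simp only [dirInner, div_pow, ← Finset.sum_div]
      rw [b.sum_sq_inner_left]
      exact div_self_le_one _
    calc _ ≤ ∫ x, (1 : ℝ) ∂μ := integral_mono
            (integrable_finsetSum _ fun i _ => integrable_dirInner_sq _ _)
            (integrable_const _) this
      _ = 1 := by simp
  simp only [heq, Finset.sum_const, Finset.card_univ, Fintype.card_fin, nsmul_eq_mul] at hsum
  rw [hu]
  simp only [dirInner_smul, mul_pow, integral_const_mul]
  rw [norm_smul, norm_norm, hv, mul_one, div_eq_mul_inv]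
  gcongr
  rw [← one_div, le_div_iff₀ (by positivity), mul_comm]
  exact hsum

end Moments

/-! ### The expected dual slack -/

section Population

open scoped RealInnerProductSpace

variable {k m : ℕ}

/-- The pointwise bound behind the loss in the own ball: `s` and `d` are the distances of a random
point from the center and from a point at distance `r` from the center, and `τ` is the scalar
product of its direction with the displacement. -/
lemma hinge_le_of_far {e s r d τ : ℝ} (he : 0 < e) (he2 : e ≤ 2) (hs0 : 0 ≤ s) (hs1 : s ≤ 1)
    (hr : e / 8 ≤ r) (hr1 : r ≤ 1) (hd : 0 ≤ d) (hsq : d ^ 2 = s ^ 2 + r ^ 2 - 2 * (s * τ)) :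
    max (1 + e / 2 - d) 0 ≤
      1 + e / 2 - s - e ^ 2 / 384 * (1 - 16 * τ ^ 2 / r ^ 4) + τ ^ 2 / r ^ 2 := by
  have hr0 : 0 < r := by linarith
  have hL : e ^ 2 / 384 ≤ r ^ 2 / 6 := by nlinarith
  have hL2 : e ^ 2 / 384 ≤ e / 2 := by nlinarith
  have hL0 : 0 ≤ e ^ 2 / 384 := by positivity
  have hW : 0 ≤ τ ^ 2 / r ^ 2 := by positivity
  have hst : (s * τ) ^ 2 ≤ τ ^ 2 := by
    rw [mul_pow]; exact mul_le_of_le_one_left (sq_nonneg _) (pow_le_one₀ hs0 hs1)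
  have hW4 : 0 ≤ 16 * τ ^ 2 / r ^ 4 := by positivity
  rcases le_or_gt s d with hsd | hsd
  · by_cases hτ : |s * τ| ≤ r ^ 2 / 4
    · have h1 : s * τ ≤ r ^ 2 / 4 := (le_abs_self _).trans hτ
      have h2 : e ^ 2 / 384 * (1 - 16 * τ ^ 2 / r ^ 4) ≤ e ^ 2 / 384 :=
        mul_le_of_le_one_right hL0 (by linarith)
      have h3 : d ≤ 2 := by
        have : -(s * τ) ≤ r ^ 2 / 4 := (neg_le_abs _).trans hτ
        nlinarith
      have h4 : r ^ 2 / 6 ≤ d - s := by nlinarith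
      exact max_le (by linarith) (by linarith)
    · have h1 : 1 ≤ 16 * τ ^ 2 / r ^ 4 := by
        rw [le_div_iff₀ (by positivity), one_mul]
        have := mul_self_le_mul_self (by positivity) (not_le.1 hτ).le
        rw [abs_mul_abs_self] at this
        nlinarith
      have h2 : e ^ 2 / 384 * (1 - 16 * τ ^ 2 / r ^ 4) ≤ 0 :=
        mul_nonpos_of_nonneg_of_nonpos hL0 (by linarith)
      exact max_le (by linarith) (by linarith)
  · have h1 : r ^ 2 < 2 * (s * τ) := by nlinarith
    have hs : 0 < s := hd.trans_lt hsd
    have hτ : 0 < τ := by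
      by_contra h
      have := mul_nonpos_of_nonneg_of_nonpos hs0 (not_lt.1 h)
      nlinarith
    have hτr : r ^ 2 < 2 * τ := by nlinarith
    -- `(s - d) (s + d) = 2 s τ - r ^ 2 ≤ s (2 τ - r ^ 2)`
    have h2 : s - d ≤ 2 * τ - r ^ 2 := by
      have : s * (s - d) ≤ s * (2 * τ - r ^ 2) := by nlinarith
      exact le_of_mul_le_mul_left this hs
    have h3 : 2 * τ - r ^ 2 ≤ τ ^ 2 / r ^ 2 := by
      rw [le_div_iff₀ (by positivity)]
      nlinarith [sq_nonneg (τ - r ^ 2)]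
    have h4 : 1 ≤ 16 * τ ^ 2 / r ^ 4 := by
      rw [le_div_iff₀ (by positivity), one_mul]
      nlinarith [sq_nonneg r]
    have h5 : e ^ 2 / 384 * (1 - 16 * τ ^ 2 / r ^ 4) ≤ 0 :=
      mul_nonpos_of_nonneg_of_nonpos hL0 (by linarith)
    exact max_le (by linarith) (by linarith)

/-- The pointwise bound for the contribution of a point of another ball, whose center has distance
`D ≥ α`. -/
lemma hinge_le_sq {α D s d τ : ℝ} (hα : 1 ≤ α) (hD : α ≤ D) (hd : 0 ≤ d)
    (hsq : d ^ 2 = s ^ 2 + D ^ 2 - 2 * (s * τ)) : max (α - d) 0 ≤ τ ^ 2 := by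
  refine max_le ?_ (sq_nonneg _)
  rcases le_or_gt α d with h | h
  · nlinarith [sq_nonneg τ]
  · nlinarith [sq_nonneg (s - τ)]

lemma dist_sq_eq (x p c : EuclideanSpace ℝ (Fin m)) :
    dist p x ^ 2 = dist x c ^ 2 + dist p c ^ 2 - 2 * (dist x c * dirInner (x - c) (p - c)) := by
  have h : dist x c * dirInner (x - c) (p - c) = ⟪x - c, p - c⟫ := by
    rw [dist_eq_norm, dirInner]
    by_cases h0 : x - c = 0
    · simp [h0]
    · rw [mul_div_cancel₀ _ (norm_ne_zero_iff.2 h0)]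
  rw [h, dist_comm p x, dist_eq_norm, dist_eq_norm, dist_eq_norm,
    ← sub_sub_sub_cancel_right x p c, norm_sub_sq_real]
  ring

lemma IsProbabilityOnBall.ae_mem {μ : Measure (EuclideanSpace ℝ (Fin m))}
    {c : EuclideanSpace ℝ (Fin m)} {r : ℝ} (h : IsProbabilityOnBall μ c r) :
    ∀ᵐ x ∂μ, dist x c ≤ r := by
  rw [ae_iff]
  exact h.2

lemma integrable_hinge {μ : Measure (EuclideanSpace ℝ (Fin m))} [IsFiniteMeasure μ] (α : ℝ)
    (p : EuclideanSpace ℝ (Fin m)) : Integrable (fun x => max (α - dist p x) 0) μ := by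
  refine Integrable.of_bound (C := |α|) ?_ (Filter.Eventually.of_forall fun x => ?_)
  · exact (by fun_prop : Continuous fun x => max (α - dist p x) 0).aestronglyMeasurable
  · rw [Real.norm_eq_abs, abs_of_nonneg (le_max_right _ _)]
    exact max_le ((sub_le_self _ dist_nonneg).trans (le_abs_self _)) (abs_nonneg _)

lemma IsProbabilityOnBall.integrable_dist {μ : Measure (EuclideanSpace ℝ (Fin m))}
    {c : EuclideanSpace ℝ (Fin m)} {r : ℝ} (h : IsProbabilityOnBall μ c r)
    (p : EuclideanSpace ℝ (Fin m)) : Integrable (fun x => dist x p) μ := by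
  have := h.1
  refine Integrable.of_bound (C := r + dist c p) ?_ ?_
  · exact (by fun_prop : Continuous fun x => dist x p).aestronglyMeasurable
  · filter_upwards [h.ae_mem] with x hx
    rw [Real.norm_eq_abs, abs_of_nonneg dist_nonneg]
    exact (dist_triangle x c p).trans (by linarith)

/-- The expected hinge contribution of the own ball, at a point that is not close to the center. -/
lemma integral_hinge_own_le {μ : Measure (EuclideanSpace ℝ (Fin m))}
    {c p : EuclideanSpace ℝ (Fin m)} {e : ℝ} (hm : 0 < m) (hμ : IsProbabilityOnBall μ c 1)
    (hrot : RotationInvariant μ c) (he : 0 < e) (he2 : e ≤ 2) (hme : 2048 ≤ e ^ 2 * m)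
    (hr : e / 8 ≤ dist p c) (hr1 : dist p c ≤ 1) :
    ∫ x, max (1 + e / 2 - dist p x) 0 ∂μ ≤
      1 + e / 2 - ∫ x, dist x c ∂μ - e ^ 2 / 768 + 1 / m := by
  have := hμ.1
  have hm0 : (0 : ℝ) < m := by exact_mod_cast hm
  set r := dist p c with hrdef
  have hr0 : 0 < r := by linarith
  have hW := hrot.integral_dirInner_sq_le hm (p - c)
  rw [← dist_eq_norm, ← hrdef] at hW
  set W := ∫ x, dirInner (x - c) (p - c) ^ 2 ∂μ
  have hIW := integrable_dirInner_sq (μ := μ) (p - c) c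
  have hId := hμ.integrable_dist c
  have h1 : ∫ x, max (1 + e / 2 - dist p x) 0 ∂μ ≤
      ∫ x, ((1 + e / 2 - e ^ 2 / 384) - dist x c
        + (e ^ 2 / 384 * (16 / r ^ 4) + 1 / r ^ 2) * dirInner (x - c) (p - c) ^ 2) ∂μ := by
    refine integral_mono_ae (integrable_hinge _ _)
      (((integrable_const _).sub hId).add (hIW.const_mul _)) ?_
    filter_upwards [hμ.ae_mem] with x hx
    refine (hinge_le_of_far he he2 dist_nonneg hx hr hr1 dist_nonneg
      (dist_sq_eq x p c)).trans_eq ?_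
    ring
  have hsub : Integrable (fun x => (1 + e / 2 - e ^ 2 / 384) - dist x c) μ :=
    (integrable_const _).sub hId
  rw [integral_add hsub (hIW.const_mul _), integral_sub (integrable_const _) hId,
    integral_const_mul, integral_const, probReal_univ, one_smul] at h1
  have h2 : (e ^ 2 / 384 * (16 / r ^ 4) + 1 / r ^ 2) * W ≤
      (e ^ 2 / 384 * (16 / r ^ 4) + 1 / r ^ 2) * (r ^ 2 / m) := by gcongr
  have h3 : (e ^ 2 / 384 * (16 / r ^ 4) + 1 / r ^ 2) * (r ^ 2 / m)
      = e ^ 2 / 384 * (16 / (r ^ 2 * m)) + 1 / m := by field_simp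
  have h4 : 16 / (r ^ 2 * m) ≤ 1 / 2 := by
    rw [div_le_iff₀ (by positivity)]
    have : (e / 8) ^ 2 ≤ r ^ 2 := by gcongr
    nlinarith
  have h5 : e ^ 2 / 384 * (16 / (r ^ 2 * m)) ≤ e ^ 2 / 384 * (1 / 2) := by gcongr
  linarith

/-- The expected hinge contribution of another ball is of order `1 / m`. -/
lemma integral_hinge_other_le {μ : Measure (EuclideanSpace ℝ (Fin m))}
    {c p : EuclideanSpace ℝ (Fin m)} {α : ℝ} (hm : 0 < m) (hμ : IsProbabilityOnBall μ c 1)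
    (hrot : RotationInvariant μ c) (hα : 1 ≤ α) (hα2 : α ≤ 2) (hD : α ≤ dist p c) :
    ∫ x, max (α - dist p x) 0 ∂μ ≤ 9 / m := by
  have := hμ.1
  rcases le_or_gt (dist p c) 3 with h3 | h3
  · calc ∫ x, max (α - dist p x) 0 ∂μ
        ≤ ∫ x, dirInner (x - c) (p - c) ^ 2 ∂μ :=
          integral_mono (integrable_hinge _ _) (integrable_dirInner_sq _ _) fun x =>
            hinge_le_sq hα hD dist_nonneg (dist_sq_eq x p c)
      _ ≤ ‖p - c‖ ^ 2 / m := hrot.integral_dirInner_sq_le hm _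
      _ ≤ 9 / m := by
          rw [← dist_eq_norm]
          gcongr
          nlinarith [dist_nonneg (x := p) (y := c)]
  · have h0 : ∫ x, max (α - dist p x) 0 ∂μ = 0 := by
      refine integral_eq_zero_of_ae ?_
      filter_upwards [hμ.ae_mem] with x hx
      have := dist_triangle p x c
      exact max_eq_right (by linarith)
    rw [h0]
    positivity

/-- The center is the unique median of a rotation invariant absolutely continuous law. -/
lemma integral_dist_center_lt {μ : Measure (EuclideanSpace ℝ (Fin m))}
    {c p : EuclideanSpace ℝ (Fin m)} (hm : 2 ≤ m) (hμ : IsProbabilityOnBall μ c 1)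
    (hrot : RotationInvariant μ c) (hac : μ ≪ volume) (hp : p ≠ c) :
    ∫ x, dist x c ∂μ < ∫ x, dist x p ∂μ := by
  have := hμ.1
  have hId := hμ.integrable_dist c
  have hIp := hμ.integrable_dist p
  have hI := integrable_dirInner (μ := μ) (p - c) c
  have hcs : ∀ x, dist x c ≤ dist x p + dirInner (x - c) (p - c) := by
    intro x
    have h1 := abs_dirInner_le (x - c) (x - p)
    have h2 : dirInner (x - c) (x - p) = dist x c - dirInner (x - c) (p - c) := by
      rw [dirInner, dirInner, ← sub_sub_sub_cancel_right x p c, inner_sub_right, sub_div,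
        real_inner_self_eq_norm_mul_norm, mul_self_div_self, dist_eq_norm]
    rw [← dist_eq_norm] at h1
    linarith [le_abs_self (dirInner (x - c) (x - p))]
  -- the points where equality holds lie on the line through `c` and `p`
  have hline : μ {x | dist x p + dirInner (x - c) (p - c) - dist x c = 0} = 0 := by
    refine hac (measure_mono_null (t := (line[ℝ, c, p] : Set _)) ?_
      (Measure.addHaar_affineSubspace _ _ ?_))
    · intro x hx
      by_cases hxc : x = c
      · rw [hxc]; exact left_mem_affineSpan_pair ℝ c p
      · have hn : ‖x - c‖ ≠ 0 := norm_ne_zero_iff.2 (sub_ne_zero.2 hxc)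
        have h1 : ⟪x - c, x - p⟫ = ‖x - c‖ * ‖x - p‖ := by
          have hx' : ‖x - p‖ + ⟪x - c, p - c⟫ / ‖x - c‖ - ‖x - c‖ = 0 := by
            rw [← dist_eq_norm, ← dist_eq_norm]
            rw [Set.mem_ofPred_eq, dirInner, dist_eq_norm] at hx
            rwa [dist_eq_norm, dist_eq_norm]
          field_simp at hx'
          rw [← sub_sub_sub_cancel_right x p c, inner_sub_right,
            real_inner_self_eq_norm_mul_norm, sub_sub_sub_cancel_right]
          linarith
        rw [inner_eq_norm_mul_iff_real] at h1
        have hne : ‖x - p‖ - ‖x - c‖ ≠ 0 := by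
          intro h
          rw [sub_eq_zero.1 h] at h1
          have := smul_right_injective _ hn h1
          exact hp (sub_right_injective this).symm
        have h2 : (‖x - p‖ - ‖x - c‖) • (x - c) = (-‖x - c‖) • (p - c) := by
          rw [sub_smul, h1, ← smul_sub, neg_smul, ← smul_neg]
          congr 1
          abel
        have h3 : x = AffineMap.lineMap c p ((‖x - p‖ - ‖x - c‖)⁻¹ * -‖x - c‖) := by
          rw [AffineMap.lineMap_apply, vsub_eq_sub, vadd_eq_add, mul_smul, ← h2, smul_smul,
            inv_mul_cancel₀ hne, one_smul, sub_add_cancel]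
        rw [h3]
        exact AffineMap.lineMap_mem_affineSpan_pair _ _ _
    · intro htop
      obtain ⟨w, hw0, hw⟩ := exists_ne_zero_inner_eq_zero hm (p - c)
      have h1 : w +ᵥ c ∈ line[ℝ, c, p] := by rw [htop]; trivial
      obtain ⟨t, ht⟩ := vadd_left_mem_affineSpan_pair.1 h1
      rw [vsub_eq_sub] at ht
      rw [← ht, real_inner_smul_right, real_inner_self_eq_norm_sq, mul_eq_zero] at hw
      have : t = 0 := hw.resolve_right (pow_ne_zero _ (norm_ne_zero_iff.2 (sub_ne_zero.2 hp)))
      exact hw0 (by rw [← ht, this, zero_smul])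
  have hsum : Integrable (fun x => dist x p + dirInner (x - c) (p - c)) μ := hIp.add hI
  have hint : ∫ x, (dist x p + dirInner (x - c) (p - c) - dist x c) ∂μ
      = ∫ x, dist x p ∂μ - ∫ x, dist x c ∂μ := by
    rw [integral_sub hsum hId, integral_add hIp hI, hrot.integral_dirInner hm, add_zero]
  have hnn : 0 ≤ fun x => dist x p + dirInner (x - c) (p - c) - dist x c := fun x =>
    sub_nonneg.2 (hcs x)
  rw [← sub_pos, ← hint]
  refine lt_of_le_of_ne (integral_nonneg hnn) fun h => ?_
  have h0 := (integral_eq_zero_iff_of_nonneg hnn (hsum.sub hId)).1 h.symm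
  have hfalse : ∀ᵐ x ∂μ, False := by
    filter_upwards [h0, measure_eq_zero_iff_ae_notMem.1 hline] with x h1 h2
    exact h2 h1
  rw [Filter.eventually_false_iff_eq_bot, ae_eq_bot] at hfalse
  exact IsProbabilityMeasure.ne_zero μ hfalse

/-- On an annulus the expected distance exceeds the one at the center by a positive margin. -/
lemma exists_gap_integral_dist {μ : Measure (EuclideanSpace ℝ (Fin m))}
    {c : EuclideanSpace ℝ (Fin m)} {ρ : ℝ} (hm : 2 ≤ m) (hμ : IsProbabilityOnBall μ c 1)
    (hrot : RotationInvariant μ c) (hac : μ ≪ volume) (hρ : 0 < ρ) :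
    ∃ γ : ℝ, 0 < γ ∧ ∀ p, dist p c ≤ 1 → ρ ≤ dist p c →
      ∫ x, dist x c ∂μ + γ ≤ ∫ x, dist x p ∂μ := by
  have := hμ.1
  have hlip : LipschitzWith 1 fun p => ∫ x, dist x p ∂μ := by
    refine LipschitzWith.of_le_add fun p p' => ?_
    calc ∫ x, dist x p ∂μ ≤ ∫ x, (dist x p' + dist p p') ∂μ :=
          integral_mono (hμ.integrable_dist p) ((hμ.integrable_dist p').add (integrable_const _))
            fun x => (dist_triangle x p' p).trans_eq (by rw [dist_comm p' p])
      _ = _ := by rw [integral_add (hμ.integrable_dist p') (integrable_const _)]; simp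
  have hK : IsCompact (Metric.closedBall c 1 ∩ {p | ρ ≤ dist p c}) :=
    (isCompact_closedBall c 1).inter_right (isClosed_le continuous_const (by fun_prop))
  rcases (Metric.closedBall c 1 ∩ {p | ρ ≤ dist p c}).eq_empty_or_nonempty with h | h
  · refine ⟨1, one_pos, fun p h1 h2 => ?_⟩
    have : p ∈ Metric.closedBall c 1 ∩ {p | ρ ≤ dist p c} := ⟨h1, h2⟩
    rw [h] at this
    exact this.elim
  · obtain ⟨p₀, hp₀, hmin⟩ := hK.exists_isMinOn h hlip.continuous.continuousOn
    have hne : p₀ ≠ c := dist_pos.1 (hρ.trans_le hp₀.2)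
    refine ⟨∫ x, dist x p₀ ∂μ - ∫ x, dist x c ∂μ,
      sub_pos.2 (integral_dist_center_lt hm hμ hrot hac hne), fun p h1 h2 => ?_⟩
    rw [add_sub_cancel]
    exact hmin ⟨h1, h2⟩

variable {c : Fin k → EuclideanSpace ℝ (Fin m)} {μ : Fin k → Measure (EuclideanSpace ℝ (Fin m))}

/-- The expected dual slack outside the cores of the balls when the separation is only slightly
more than `2`: the loss in the own ball is of order `e ^ 2`, the gain from the other balls of order
`k / m`. -/
lemma exists_slack_of_high_dim {e : ℝ} (hm : 2 ≤ m) (hμ : ∀ i, IsProbabilityOnBall (μ i) (c i) 1)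
    (hrot : ∀ i, RotationInvariant (μ i) (c i)) (he : 0 < e) (he2 : e ≤ 2)
    (hme : 27000 * k ≤ e ^ 2 * m) (hsep : ∀ i j, i ≠ j → 2 + e < dist (c i) (c j)) :
    ∃ γ : ℝ, 0 < γ ∧ ∀ i p, dist p (c i) ≤ 1 → e / 8 ≤ dist p (c i) →
      ∑ j, ∫ x, max (1 + e / 2 - dist p x) 0 ∂μ j
        ≤ 1 + e / 2 - ∫ x, dist x (c i) ∂μ i - γ := by
  have hm0 : (0 : ℝ) < m := by exact_mod_cast (by omega : 0 < m)
  refine ⟨1 / m, by positivity, fun i p hp1 hp => ?_⟩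
  have hk : (1 : ℝ) ≤ k := by exact_mod_cast i.pos
  have hown := integral_hinge_own_le (by omega) (hμ i) (hrot i) he he2 (by linarith) hp hp1
  have hother : ∑ j ∈ Finset.univ.erase i, ∫ x, max (1 + e / 2 - dist p x) 0 ∂μ j
      ≤ k * (9 / m) := by
    calc _ ≤ ∑ j ∈ Finset.univ.erase i, (9 / m : ℝ) := by
          refine Finset.sum_le_sum fun j hj => ?_
          have h1 := hsep i j (Finset.ne_of_mem_erase hj).symm
          have h2 := dist_triangle_left (c i) (c j) p
          exact integral_hinge_other_le (by omega) (hμ j) (hrot j) (by linarith) (by linarith)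
            (by linarith)
      _ ≤ k * (9 / m) := by
          rw [Finset.sum_const, nsmul_eq_mul]
          gcongr
          exact_mod_cast (Finset.card_le_univ _).trans_eq (Fintype.card_fin k)
  have hgap : (k : ℝ) * (9 / m) + 2 * (1 / m) ≤ e ^ 2 / 768 := by
    have h1 : (k : ℝ) * (9 / m) + 2 * (1 / m) = (9 * k + 2) / m := by ring
    rw [h1, div_le_iff₀ hm0]
    linarith
  rw [← Finset.add_sum_erase _ _ (Finset.mem_univ i)]
  linarith

/-- The expected dual slack outside the cores of the balls when the balls are far apart: the hinge
is never active, and only the unique median property of the center is needed. -/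
lemma exists_slack_of_far_apart (hm : 2 ≤ m) (hμ : ∀ i, IsProbabilityOnBall (μ i) (c i) 1)
    (hrot : ∀ i, RotationInvariant (μ i) (c i)) (hac : ∀ i, μ i ≪ volume)
    (hsep : ∀ i j, i ≠ j → 4 < dist (c i) (c j)) {ρ : ℝ} (hρ : 0 < ρ) :
    ∃ γ : ℝ, 0 < γ ∧ ∀ i p, dist p (c i) ≤ 1 → ρ ≤ dist p (c i) →
      ∑ j, ∫ x, max (2 - dist p x) 0 ∂μ j ≤ 2 - ∫ x, dist x (c i) ∂μ i - γ := by
  choose γ hγ hgap using fun i => exists_gap_integral_dist hm (hμ i) (hrot i) (hac i) hρ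
  obtain ⟨γ₀, hγ₀, hle⟩ : ∃ γ₀ : ℝ, 0 < γ₀ ∧ ∀ i, γ₀ ≤ γ i := by
    have h1 : ∀ᶠ t in nhdsWithin (0 : ℝ) (Set.Ioi 0), ∀ i, t ≤ γ i :=
      Filter.eventually_all.2 fun i =>
        nhdsWithin_le_nhds (eventually_le_nhds (hγ i))
    obtain ⟨t, ht, ht0⟩ := (h1.and self_mem_nhdsWithin).exists
    exact ⟨t, ht0, ht⟩
  refine ⟨γ₀, hγ₀, fun i p hp1 hp => ?_⟩
  have := (hμ i).1
  have hown : ∫ x, max (2 - dist p x) 0 ∂μ i = 2 - ∫ x, dist x p ∂μ i := by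
    calc _ = ∫ x, (2 - dist x p) ∂μ i := by
          refine integral_congr_ae ?_
          filter_upwards [(hμ i).ae_mem] with x hx
          have := dist_triangle_right p x (c i)
          rw [max_eq_left (by linarith), dist_comm]
      _ = _ := by rw [integral_sub (integrable_const _) ((hμ i).integrable_dist p)]; simp
  have hother : ∀ j ∈ Finset.univ.erase i, ∫ x, max (2 - dist p x) 0 ∂μ j = 0 := by
    intro j hj
    refine integral_eq_zero_of_ae ?_
    filter_upwards [(hμ j).ae_mem] with x hx
    have h1 := hsep i j (Finset.ne_of_mem_erase hj).symm
    have h2 := dist_triangle_left (c i) (c j) p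
    have h3 := dist_triangle p x (c j)
    exact max_eq_right (by linarith)
  rw [← Finset.add_sum_erase _ _ (Finset.mem_univ i), Finset.sum_eq_zero hother, hown]
  linarith [hgap i p hp1 hp, hle i]

end Population

/-! ### Sample averages -/

section Sampling

open scoped RealInnerProductSpace Topology
open ProbabilityTheory Filter

variable {k m : ℕ} {μ : Fin k → Measure (EuclideanSpace ℝ (Fin m))}

instance [∀ i, IsProbabilityMeasure (μ i)] (n : ℕ) : IsProbabilityMeasure (sampleLaw n μ) := by
  unfold sampleLaw
  infer_instance

/-- The one-sided weak law of large numbers for the points drawn from one of the balls. -/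
lemma tendsto_sampleLaw_average_gt [∀ i, IsProbabilityMeasure (μ i)] (j : Fin k)
    {f : EuclideanSpace ℝ (Fin m) → ℝ} (hf : MemLp f 2 (μ j)) {η : ℝ} (hη : 0 < η) :
    Tendsto (fun n => sampleLaw n μ {x | ∫ y, f y ∂μ j + η < (∑ a, f (x (j, a))) / n})
      atTop (𝓝 0) := by
  classical
  set E := ∫ y, f y ∂μ j
  have hbound : ∀ n : ℕ, 0 < n → sampleLaw n μ {x | E + η < (∑ a, f (x (j, a))) / n}
      ≤ ENNReal.ofReal (Var[f; μ j] / η ^ 2 / n) := by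
    intro n hn
    have hn0 : (0 : ℝ) < n := by exact_mod_cast hn
    set X : Fin k × Fin n → EuclideanSpace ℝ (Fin m) → ℝ := fun p => if p.1 = j then f else 0
    have hX : ∀ p, MemLp (X p) 2 (μ p.1) := by
      intro p
      by_cases h : p.1 = j
      · simp only [X, if_pos h]; rw [h]; exact hf
      · simp only [X, if_neg h]; exact MemLp.zero
    have hsum : (∑ p, fun x : Fin k × Fin n → EuclideanSpace ℝ (Fin m) => X p (x p))
        = fun x => ∑ a, f (x (j, a)) := by
      ext x
      rw [Finset.sum_apply, Fintype.sum_prod_type, Finset.sum_eq_single j]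
      · simp [X]
      · intro i _ hi; simp [X, hi]
      · simp
    have hL : ∀ p, MemLp (fun x : Fin k × Fin n → EuclideanSpace ℝ (Fin m) => X p (x p)) 2
        (sampleLaw n μ) := fun p => (hX p).comp_measurePreserving (measurePreserving_eval _ p)
    have hvar : Var[fun x => ∑ a, f (x (j, a)); sampleLaw n μ] = n * Var[f; μ j] := by
      rw [← hsum, sampleLaw, variance_sum_pi hX, Fintype.sum_prod_type, Finset.sum_eq_single j]
      · simp [X]
      · intro i _ hi; simp [X, hi]
      · simp
    have hmean : ∫ x, ∑ a, f (x (j, a)) ∂sampleLaw n μ = n * E := by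
      have hfa : ∀ a : Fin n, Integrable (fun x : Fin k × Fin n → EuclideanSpace ℝ (Fin m) =>
          f (x (j, a))) (sampleLaw n μ) := fun a =>
        (hf.comp_measurePreserving (measurePreserving_eval (fun p : Fin k × Fin n => μ p.1)
          (j, a))).integrable one_le_two
      rw [integral_finsetSum _ fun a _ => hfa a]
      have : ∀ a : Fin n, ∫ x, f (x (j, a)) ∂sampleLaw n μ = E := fun a =>
        integral_comp_eval (μ := fun p : Fin k × Fin n => μ p.1) (i := (j, a))
          hf.aestronglyMeasurable
      simp [this]
    have hmem : MemLp (fun x => ∑ a, f (x (j, a))) 2 (sampleLaw n μ) := by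
      rw [← hsum]
      exact memLp_finsetSum' _ fun p _ => hL p
    calc sampleLaw n μ {x | E + η < (∑ a, f (x (j, a))) / n}
        ≤ sampleLaw n μ {x | n * η ≤
            |∑ a, f (x (j, a)) - ∫ x, ∑ a, f (x (j, a)) ∂sampleLaw n μ|} := by
          refine measure_mono fun x hx => ?_
          have hx' : E + η < (∑ a, f (x (j, a))) / n := hx
          rw [lt_div_iff₀ hn0] at hx'
          change n * η ≤ |_|
          rw [hmean]
          exact le_trans (by linarith) (le_abs_self _)
      _ ≤ ENNReal.ofReal (Var[fun x => ∑ a, f (x (j, a)); sampleLaw n μ] / (n * η) ^ 2) :=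
          meas_ge_le_variance_div_sq hmem (by positivity)
      _ = ENNReal.ofReal (Var[f; μ j] / η ^ 2 / n) := by
          rw [hvar]
          congr 1
          field_simp
  have hlim : Tendsto (fun n : ℕ => ENNReal.ofReal (Var[f; μ j] / η ^ 2 / n)) atTop (𝓝 0) := by
    rw [← ENNReal.ofReal_zero]
    exact ENNReal.tendsto_ofReal (tendsto_const_div_atTop_nhds_zero_nat _)
  exact tendsto_of_tendsto_of_tendsto_of_le_of_le' tendsto_const_nhds hlim
    (Eventually.of_forall fun _ => zero_le) ((eventually_gt_atTop 0).mono hbound)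

/-! ### Sample medians are unique -/

/-- A level set of a sum of distances lies in the frontier of the convex sublevel set, since a sum
of distances has no local maximum. -/
lemma volume_level_set_sum_dist {ι : Type*} (hm : 2 ≤ m) {s : Finset ι} (hs : s.Nonempty)
    (y : ι → EuclideanSpace ℝ (Fin m)) (t : ℝ) :
    volume {p | ∑ b ∈ s, dist p (y b) = t} = 0 := by
  set f : EuclideanSpace ℝ (Fin m) → ℝ := fun p => ∑ b ∈ s, dist p (y b) with hf
  have hconv : Convex ℝ {p | f p ≤ t} := by
    have : ConvexOn ℝ Set.univ f := by
      refine ⟨convex_univ, fun p _ q _ a b ha hb hab => ?_⟩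
      simp only [hf, smul_eq_mul, Finset.mul_sum, ← Finset.sum_add_distrib]
      exact Finset.sum_le_sum fun i _ =>
        (convexOn_univ_dist (y i)).2 (Set.mem_univ p) (Set.mem_univ q) ha hb hab
    simpa using this.convex_le t
  refine measure_mono_null (fun p hp => ?_) (hconv.addHaar_frontier volume)
  have hp' : f p = t := hp
  refine ⟨subset_closure hp'.le, fun hint => ?_⟩
  obtain ⟨b₀, hb₀⟩ := hs
  -- moving orthogonally to `p - y b₀` in both directions increases the sum of the two values
  obtain ⟨w, hw0, hw⟩ := exists_ne_zero_inner_eq_zero hm (p - y b₀)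
  have hnear : ∀ᶠ r : ℝ in 𝓝[>] 0, f (p + r • w) ≤ t ∧ f (p - r • w) ≤ t := by
    have hU : {p | f p ≤ t} ∈ 𝓝 p := mem_interior_iff_mem_nhds.1 hint
    have h1 : Tendsto (fun r : ℝ => p + r • w) (𝓝 0) (𝓝 p) := by
      have : Continuous fun r : ℝ => p + r • w := by fun_prop
      simpa using this.tendsto 0
    have h2 : Tendsto (fun r : ℝ => p - r • w) (𝓝 0) (𝓝 p) := by
      have : Continuous fun r : ℝ => p - r • w := by fun_prop
      simpa using this.tendsto 0
    exact nhdsWithin_le_nhds ((h1.eventually hU).and (h2.eventually hU))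
  obtain ⟨r, ⟨hr1, hr2⟩, hr⟩ := (hnear.and self_mem_nhdsWithin).exists
  have hmid : ∀ b, 2 * dist p (y b) ≤ dist (p + r • w) (y b) + dist (p - r • w) (y b) := by
    intro b
    simp only [dist_eq_norm]
    calc 2 * ‖p - y b‖ = ‖(p + r • w - y b) + (p - r • w - y b)‖ := by
          rw [show (p + r • w - y b) + (p - r • w - y b) = (2 : ℝ) • (p - y b) by
            rw [two_smul]; abel, norm_smul]
          norm_num
      _ ≤ _ := norm_add_le _ _
  have hstrict : 2 * dist p (y b₀) < dist (p + r • w) (y b₀) + dist (p - r • w) (y b₀) := by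
    have hrw : 0 < ‖r • w‖ := norm_pos_iff.2 (smul_ne_zero (ne_of_gt hr) hw0)
    have horth : ⟪p - y b₀, r • w⟫ = 0 := by rw [real_inner_smul_right, hw, mul_zero]
    have h1 : ‖p - y b₀‖ < ‖p - y b₀ + r • w‖ := by
      refine lt_of_pow_lt_pow_left₀ 2 (norm_nonneg _) ?_
      rw [norm_add_sq_real, horth]
      nlinarith
    have h2 : ‖p - y b₀‖ < ‖p - y b₀ - r • w‖ := by
      refine lt_of_pow_lt_pow_left₀ 2 (norm_nonneg _) ?_
      rw [norm_sub_sq_real (p - y b₀), horth]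
      nlinarith
    simp only [dist_eq_norm, add_sub_right_comm p, sub_right_comm p (r • w)]
    linarith
  have hlt : ∑ b ∈ s, 2 * dist p (y b)
      < ∑ b ∈ s, (dist (p + r • w) (y b) + dist (p - r • w) (y b)) :=
    Finset.sum_lt_sum (fun b _ => hmid b) ⟨b₀, hb₀, hstrict⟩
  rw [← Finset.mul_sum, Finset.sum_add_distrib] at hlt
  simp only [hf] at hp' hr1 hr2
  linarith

/-- A measurable set all of whose sections along one coordinate are null is null. -/
lemma measure_pi_eq_zero_of_sections {ι : Type*} [Fintype ι] [DecidableEq ι] {X : ι → Type*}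
    [∀ i, MeasurableSpace (X i)] {ν : ∀ i, Measure (X i)} [∀ i, SigmaFinite (ν i)]
    {S : Set (∀ i, X i)} (hS : MeasurableSet S) (i : ι)
    (h : ∀ x, ν i {y | Function.update x i y ∈ S} = 0) : Measure.pi ν S = 0 := by
  rcases S.eq_empty_or_nonempty with rfl | ⟨x₀, -⟩
  · simp
  have hmeas : Measurable (S.indicator (1 : (∀ i, X i) → ENNReal)) :=
    measurable_one.indicator hS
  rw [← lintegral_indicator_one hS, lintegral_eq_lmarginal_univ x₀,
    lmarginal_erase' _ hmeas (Finset.mem_univ i)]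
  have : (fun x => ∫⁻ y, S.indicator (1 : (∀ i, X i) → ENNReal) (Function.update x i y) ∂ν i)
      = 0 := by
    ext x
    exact (lintegral_indicator_one (hS.preimage (measurable_update x))).trans (h x)
  rw [this]
  simp [lmarginal]

/-- Two different points of a sample almost surely have different sums of distances to the points
drawn from the same ball. -/
lemma sampleLaw_sum_dist_eq_null [∀ i, IsProbabilityMeasure (μ i)] (hm : 2 ≤ m)
    (hac : ∀ i, μ i ≪ volume) {n : ℕ} (hn : 3 ≤ n) (i : Fin k) {a a' : Fin n} (ha : a ≠ a') :
    sampleLaw n μ {x | ∑ b, dist (x (i, a)) (x (i, b)) = ∑ b, dist (x (i, a')) (x (i, b))} = 0 := by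
  classical
  refine measure_pi_eq_zero_of_sections
    (isClosed_eq (by fun_prop) (by fun_prop)).measurableSet (i, a) fun x => ?_
  refine hac i (measure_mono_null (fun y hy => ?_) (volume_level_set_sum_dist hm
    (s := (Finset.univ.erase a).erase a') ?_ (fun b => x (i, b))
    (∑ b ∈ (Finset.univ.erase a).erase a', dist (x (i, a')) (x (i, b)))))
  · have hup : ∀ b, b ≠ a → Function.update x (i, a) y (i, b) = x (i, b) := fun b hb =>
      Function.update_of_ne (fun h => hb (Prod.ext_iff.1 h).2) _ _
    have hmem : a' ∈ Finset.univ.erase a := Finset.mem_erase.2 ⟨ha.symm, Finset.mem_univ _⟩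
    have hsplit : ∀ g : Fin n → ℝ,
        ∑ b, g b = g a + (g a' + ∑ b ∈ (Finset.univ.erase a).erase a', g b) := fun g => by
      rw [Finset.add_sum_erase _ _ hmem, Finset.add_sum_erase _ _ (Finset.mem_univ a)]
    have hcongr : ∀ z, ∑ b ∈ (Finset.univ.erase a).erase a',
        dist z (Function.update x (i, a) y (i, b))
          = ∑ b ∈ (Finset.univ.erase a).erase a', dist z (x (i, b)) := fun z =>
      Finset.sum_congr rfl fun b hb => by
        rw [hup b (Finset.ne_of_mem_erase (Finset.mem_of_mem_erase hb))]
    have hy' : ∑ b, dist (Function.update x (i, a) y (i, a)) (Function.update x (i, a) y (i, b))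
        = ∑ b, dist (Function.update x (i, a) y (i, a')) (Function.update x (i, a) y (i, b)) := hy
    rw [hsplit, hsplit, hcongr, hcongr, hup a' ha.symm, Function.update_self, dist_self,
      dist_self, dist_comm y] at hy'
    change ∑ b ∈ _, dist y (x (i, b)) = _
    linarith
  · rw [← Finset.card_pos, Finset.card_erase_of_mem
      (Finset.mem_erase.2 ⟨ha.symm, Finset.mem_univ _⟩), Finset.card_erase_of_mem
      (Finset.mem_univ _), Finset.card_univ, Fintype.card_fin]
    omega

end Sampling

/-! ### From a typical sample to the certificate -/

section Sample

variable {k m n : ℕ}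

/-- A sample that is typical up to the precision `η` admits a dual certificate: the dual variable
of a point of the ball `i` is `α`, corrected by the deviation of the average median cost of that
ball from the common expected distance `E`. -/
lemma exactRecovery_of_typical {c : Fin k → EuclideanSpace ℝ (Fin m)} {α ρ γ η E : ℝ}
    (hn : 0 < n) (hη : 0 < η) (hηρ : η ≤ ρ) (hηγ : 4 * k * η < γ) (hα : 1 + 4 * ρ ≤ α)
    (hsep : ∀ i j, i ≠ j → α + 4 * ρ + 1 ≤ dist (c i) (c j))
    {x : Fin k × Fin n → EuclideanSpace ℝ (Fin m)}
    (hball : ∀ i a, dist (x (i, a)) (c i) ≤ 1)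
    (hcore : ∀ i, ∃ a, dist (x (i, a)) (c i) ≤ η)
    (hup : ∀ i, ∑ a, dist (x (i, a)) (c i) ≤ n * (E + η))
    (hlow : ∀ i, n * (E - η) ≤ ∑ a, dist (x (i, a)) (c i))
    (hslack : ∀ i p, dist p (c i) ≤ 1 → ρ ≤ dist p (c i) →
      ∑ j, ∑ b, max (α - dist p (x (j, b))) 0 ≤ n * (α - E - γ + 2 * k * η))
    (htie : ∀ i a a', a ≠ a' →
      ∑ b, dist (x (i, a)) (x (i, b)) ≠ ∑ b, dist (x (i, a')) (x (i, b))) :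
    ExactRecovery k Prod.fst x := by
  have hn0 : (0 : ℝ) < n := by exact_mod_cast hn
  have : Nonempty (Fin n) := ⟨⟨0, hn⟩⟩
  set S : Fin k → Fin n → ℝ := fun i a => ∑ b, dist (x (i, a)) (x (i, b)) with hS
  choose med hmed using fun i => Finite.exists_min (S i)
  set A : Fin k → ℝ := fun i => α + S i (med i) / n - E with hA
  have hnA : ∀ i, n * A i = n * (α - E) + S i (med i) := fun i => by
    simp only [hA]; field_simp; ring
  -- the median cost is within `2 η` above and `ρ + η` below its expectation
  have hSup : ∀ i, S i (med i) ≤ n * (E + 2 * η) := by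
    intro i
    obtain ⟨a, ha⟩ := hcore i
    calc S i (med i) ≤ S i a := hmed i a
      _ ≤ ∑ b, (η + dist (x (i, b)) (c i)) := Finset.sum_le_sum fun b _ =>
          (dist_triangle_right _ _ (c i)).trans (by linarith)
      _ ≤ n * (E + 2 * η) := by
          rw [Finset.sum_add_distrib, Finset.sum_const, Finset.card_univ, Fintype.card_fin,
            nsmul_eq_mul]
          linarith [hup i]
  have hfar : ∀ i a, ρ ≤ dist (x (i, a)) (c i) → S i (med i) < S i a := by
    intro i a ha
    have hk : (1 : ℝ) ≤ k := by exact_mod_cast i.pos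
    have h1 := hslack i (x (i, a)) (hball i a) ha
    have h2 : n * α - S i a ≤ ∑ j, ∑ b, max (α - dist (x (i, a)) (x (j, b))) 0 := by
      calc n * α - S i a = ∑ b, (α - dist (x (i, a)) (x (i, b))) := by simp [hS]
        _ ≤ ∑ b, max (α - dist (x (i, a)) (x (i, b))) 0 :=
            Finset.sum_le_sum fun b _ => le_max_left _ _
        _ ≤ _ := Finset.single_le_sum (f := fun j => ∑ b, max (α - dist (x (i, a)) (x (j, b))) 0)
            (fun j _ => Finset.sum_nonneg fun b _ => le_max_right _ _) (Finset.mem_univ i)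
    have h3 : n * (E + 2 * η) < n * (E + γ - 2 * k * η) :=
      mul_lt_mul_of_pos_left (by nlinarith) hn0
    have h4 := hSup i
    linarith
  have hcoreMed : ∀ i, dist (x (i, med i)) (c i) < ρ := fun i => by
    by_contra h
    exact lt_irrefl _ (hfar i (med i) (not_lt.1 h))
  have hSlow : ∀ i, n * (E - η - ρ) ≤ S i (med i) := by
    intro i
    calc n * (E - η - ρ) ≤ ∑ b, (dist (x (i, b)) (c i) - ρ) := by
          rw [Finset.sum_sub_distrib, Finset.sum_const, Finset.card_univ, Fintype.card_fin,
            nsmul_eq_mul]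
          linarith [hlow i]
      _ ≤ S i (med i) := Finset.sum_le_sum fun b _ => by
          linarith [dist_triangle_left (x (i, b)) (c i) (x (i, med i)), hcoreMed i]
  have hAup : ∀ i, A i ≤ α + 2 * η := fun i => by
    have := hSup i
    have h := hnA i
    exact le_of_mul_le_mul_left (by linarith) hn0
  have hAlow : ∀ i, 1 + 2 * ρ ≤ A i := fun i => by
    have := hSlow i
    have h := hnA i
    have h2 : n * (1 + 2 * ρ) ≤ n * (α - η - ρ) := mul_le_mul_of_nonneg_left (by linarith) hn0.le
    exact le_of_mul_le_mul_left (by linarith) hn0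
  have hown : ∀ i a b, dist (x (i, a)) (c i) ≤ ρ → dist (x (i, a)) (x (i, b)) ≤ A i := by
    intro i a b ha
    linarith [dist_triangle_right (x (i, a)) (x (i, b)) (c i), hball i b, hAlow i]
  have hother : ∀ i a j b, j ≠ i → dist (x (i, a)) (c i) ≤ ρ →
      A j < dist (x (i, a)) (x (j, b)) := by
    intro i a j b hij ha
    have h1 := dist_triangle4 (c i) (x (i, a)) (x (j, b)) (c j)
    rw [dist_comm (c i) (x (i, a))] at h1
    linarith [hball j b, hAup j, hsep i j hij.symm]
  have hcore_sum : ∀ i a, dist (x (i, a)) (c i) ≤ ρ →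
      ∑ q : Fin k × Fin n, max (A q.1 - dist (x (i, a)) (x q)) 0
        = n * (α - E) + S i (med i) - S i a := by
    intro i a ha
    rw [Fintype.sum_prod_type, Finset.sum_eq_single i]
    · calc ∑ b, max (A i - dist (x (i, a)) (x (i, b))) 0
          = ∑ b, (A i - dist (x (i, a)) (x (i, b))) :=
            Finset.sum_congr rfl fun b _ => max_eq_left (sub_nonneg.2 (hown i a b ha))
        _ = n * A i - S i a := by simp [hS]
        _ = _ := by rw [hnA]
    · intro j _ hj
      exact Finset.sum_eq_zero fun b _ =>
        max_eq_right (sub_nonpos.2 (hother i a j b hj ha).le)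
    · simp
  refine exactRecovery_of_certificate x (fun i => (i, med i)) (fun _ => rfl) (fun q => A q.1)
    (n * (α - E)) (fun q => hown _ _ _ (hcoreMed _).le)
    (fun i q hq => hother _ _ _ _ hq (hcoreMed _).le)
    (fun i => by rw [hcore_sum i _ (hcoreMed i).le]; ring) ?_
  rintro ⟨i, a⟩ hp
  have hne : a ≠ med i := fun h => hp i (by rw [h])
  rcases le_or_gt (dist (x (i, a)) (c i)) ρ with ha | ha
  · rw [hcore_sum i a ha]
    have := lt_of_le_of_ne (hmed i a) (htie i _ _ hne.symm)
    linarith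
  · calc ∑ q : Fin k × Fin n, max (A q.1 - dist (x (i, a)) (x q)) 0
        ≤ ∑ j, ∑ b, (max (α - dist (x (i, a)) (x (j, b))) 0 + 2 * η) := by
          rw [Fintype.sum_prod_type]
          refine Finset.sum_le_sum fun j _ => Finset.sum_le_sum fun b _ => ?_
          have h1 := le_max_left (α - dist (x (i, a)) (x (j, b))) 0
          have h2 := le_max_right (α - dist (x (i, a)) (x (j, b))) 0
          exact max_le (by linarith [hAup j]) (by linarith)
      _ ≤ n * (α - E - γ + 2 * k * η) + k * (n * (2 * η)) := by
          simp only [Finset.sum_add_distrib, Finset.sum_const, Finset.card_univ, Fintype.card_fin,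
            nsmul_eq_mul]
          linarith [hslack i _ (hball i a) ha.le]
      _ = n * (α - E) - n * (γ - 4 * k * η) := by ring
      _ < n * (α - E) := by
          have := mul_pos hn0 (sub_pos.2 hηγ)
          linarith

/-! ### Typical samples have high probability -/

open scoped Topology
open Filter

/-- If the outer probabilities of the complements tend to `0`, the events happen with high
probability, whether or not they are measurable. -/
lemma withHighProbability_of_tendsto_compl {Ω : ℕ → Type*} [∀ n, MeasurableSpace (Ω n)]
    {P : ∀ n, Measure (Ω n)} [∀ n, IsProbabilityMeasure (P n)] {A : ∀ n, Set (Ω n)}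
    (h : Tendsto (fun n => P n (A n)ᶜ) atTop (𝓝 0)) : WithHighProbability P A := by
  intro δ hδ hδ1
  obtain ⟨N, hN⟩ := eventually_atTop.1
    (h.eventually (gt_mem_nhds (ENNReal.ofReal_pos.2 hδ)))
  refine ⟨N, fun n hn => ⟨(toMeasurable (P n) (A n)ᶜ)ᶜ, (measurableSet_toMeasurable _ _).compl,
    Set.compl_subset_comm.1 (subset_toMeasurable _ _), ?_⟩⟩
  rw [prob_compl_eq_one_sub (measurableSet_toMeasurable _ _), measure_toMeasurable,
    lt_tsub_iff_right]
  calc ENNReal.ofReal (1 - δ) + P n (A n)ᶜ < ENNReal.ofReal (1 - δ) + ENNReal.ofReal δ :=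
        ENNReal.add_lt_add_left ENNReal.ofReal_ne_top (hN n hn.le)
    _ = 1 := by
        rw [← ENNReal.ofReal_add (sub_nonneg.2 hδ1.le) hδ.le, sub_add_cancel, ENNReal.ofReal_one]

lemma tendsto_measure_iUnion_zero {Ω : ℕ → Type*} [∀ n, MeasurableSpace (Ω n)]
    {P : ∀ n, Measure (Ω n)} {T : Type*} [Fintype T] {B : ∀ n, T → Set (Ω n)}
    (h : ∀ t, Tendsto (fun n => P n (B n t)) atTop (𝓝 0)) :
    Tendsto (fun n => P n (⋃ t, B n t)) atTop (𝓝 0) := by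
  have hsum : Tendsto (fun n => ∑ t, P n (B n t)) atTop (𝓝 0) := by
    simpa using tendsto_finsetSum Finset.univ fun t _ => h t
  exact tendsto_of_tendsto_of_tendsto_of_le_of_le tendsto_const_nhds hsum (fun _ => zero_le)
    fun n => measure_iUnion_fintype_le _ _

lemma NullOnLebesgueNull.absolutelyContinuous {ν : Measure (EuclideanSpace ℝ (Fin m))}
    {a : EuclideanSpace ℝ (Fin m)} {r : ℝ} (h : NullOnLebesgueNull ν a r)
    (hν : IsProbabilityOnBall ν a r) : ν ≪ volume := by
  intro S hS
  rw [← Set.inter_union_compl S (Metric.closedBall a r)]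
  exact measure_union_null
    (h _ Set.inter_subset_right (measure_mono_null Set.inter_subset_left hS))
    (measure_mono_null Set.inter_subset_right hν.2)

variable {c : Fin k → EuclideanSpace ℝ (Fin m)} {μ : Fin k → Measure (EuclideanSpace ℝ (Fin m))}

/-- Exact recovery with high probability, for every choice of a dual variable `α`, of a radius `ρ`
of the cores of the balls and of a margin `γ` for which the expected dual slack outside the cores
is at least `γ`. -/
lemma withHighProbability_of_slack {α ρ γ E : ℝ} (hm : 2 ≤ m)
    (hμ : ∀ i, IsProbabilityOnBall (μ i) (c i) 1)
    (hpos : ∀ i, PositiveNearCenter (μ i) (c i) 1) (hac : ∀ i, μ i ≪ volume)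
    (hE : ∀ i, ∫ x, dist x (c i) ∂μ i = E) (hρ : 0 < ρ) (hγ : 0 < γ) (hα : 1 + 4 * ρ ≤ α)
    (hsep : ∀ i j, i ≠ j → α + 4 * ρ + 1 ≤ dist (c i) (c j))
    (hslack : ∀ i p, dist p (c i) ≤ 1 → ρ ≤ dist p (c i) →
      ∑ j, ∫ x, max (α - dist p x) 0 ∂μ j ≤ α - E - γ) :
    WithHighProbability (fun n => sampleLaw n μ)
      (fun n => {x : Fin k × Fin n → EuclideanSpace ℝ (Fin m) | ExactRecovery k Prod.fst x}) := by
  classical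
  have hprob : ∀ i, IsProbabilityMeasure (μ i) := fun i => (hμ i).1
  obtain ⟨η, hη, hη1, hηρ, hηγ⟩ : ∃ η : ℝ, 0 < η ∧ η ≤ 1 ∧ η ≤ ρ ∧ 4 * k * η < γ := by
    refine ⟨min 1 (min ρ (γ / (4 * k + 1))), by positivity, min_le_left _ _,
      (min_le_right _ _).trans (min_le_left _ _), ?_⟩
    have h1 : min 1 (min ρ (γ / (4 * k + 1))) ≤ γ / (4 * k + 1) :=
      (min_le_right _ _).trans (min_le_right _ _)
    rw [le_div_iff₀ (by positivity)] at h1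
    have h2 : 0 < min 1 (min ρ (γ / (4 * k + 1))) := by positivity
    linarith
  -- finite nets of the annuli
  have hnet : ∀ i, ∃ N : Finset (EuclideanSpace ℝ (Fin m)),
      (∀ p ∈ N, dist p (c i) ≤ 1 ∧ ρ ≤ dist p (c i)) ∧
      ∀ p, dist p (c i) ≤ 1 → ρ ≤ dist p (c i) → ∃ p' ∈ N, dist p p' ≤ η := by
    intro i
    have hK : IsCompact (Metric.closedBall (c i) 1 ∩ {p | ρ ≤ dist p (c i)}) :=
      (isCompact_closedBall (c i) 1).inter_right (isClosed_le continuous_const (by fun_prop))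
    obtain ⟨t, ht, hfin, hcov⟩ := hK.finite_cover_balls hη
    refine ⟨hfin.toFinset, fun p hp => ht (hfin.mem_toFinset.1 hp), fun p h1 h2 => ?_⟩
    obtain ⟨p', hp', hd⟩ := Set.mem_iUnion₂.1 (hcov ⟨h1, h2⟩)
    exact ⟨p', hfin.mem_toFinset.2 hp', (Metric.mem_ball.1 hd).le⟩
  choose N hN hNcov using hnet
  -- the core of every ball is charged
  have hcore : ∀ i, 0 < (μ i).real (Metric.ball (c i) η) := fun i =>
    ENNReal.toReal_pos (hpos i _ Metric.isOpen_ball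
      ((Metric.ball_subset_ball hη1).trans Metric.ball_subset_closedBall)
      (Metric.mem_ball_self hη)).ne' (measure_ne_top _ _)
  -- minus the indicator of the core, so that a one-sided law of large numbers applies
  set fcore : Fin k → EuclideanSpace ℝ (Fin m) → ℝ := fun i =>
    (Metric.ball (c i) η).indicator fun _ => (-1 : ℝ) with hfcore
  have hfcoreL : ∀ i, MemLp (fcore i) 2 (μ i) := fun i =>
    (memLp_const _).indicator Metric.isOpen_ball.measurableSet
  have hfcoreI : ∀ i, ∫ y, fcore i y ∂μ i = -(μ i).real (Metric.ball (c i) η) := fun i => by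
    rw [hfcore, integral_indicator_const _ Metric.isOpen_ball.measurableSet]
    simp
  have hdistL : ∀ i, MemLp (fun y => dist y (c i)) 2 (μ i) := by
    intro i
    refine MemLp.of_bound
      (by fun_prop : Continuous fun y => dist y (c i)).aestronglyMeasurable 1 ?_
    filter_upwards [(hμ i).ae_mem] with y hy
    rwa [Real.norm_eq_abs, abs_of_nonneg dist_nonneg]
  have hhingeL : ∀ j p, MemLp (fun y => max (α - dist p y) 0) 2 (μ j) := by
    intro j p
    refine MemLp.of_bound
      (by fun_prop : Continuous fun y => max (α - dist p y) 0).aestronglyMeasurable |α|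
      (Eventually.of_forall fun y => ?_)
    rw [Real.norm_eq_abs, abs_of_nonneg (le_max_right _ _)]
    exact max_le ((sub_le_self _ dist_nonneg).trans (le_abs_self _)) (abs_nonneg _)
  -- the exceptional events: no point falls into the core of a ball (`B₁`), an average distance to
  -- a center (`B₂`, `B₃`) or an average hinge at a point of a net (`B₄`) is off, a point lies
  -- outside its ball (`B₅`), two points of a ball have equal median costs (`B₆`)
  let B₁ : ∀ n, Fin k → Set (Fin k × Fin n → EuclideanSpace ℝ (Fin m)) := fun n i =>
    {x | ∫ y, fcore i y ∂μ i + (μ i).real (Metric.ball (c i) η) / 2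
      < (∑ a, fcore i (x (i, a))) / n}
  let B₂ : ∀ n, Fin k → Set (Fin k × Fin n → EuclideanSpace ℝ (Fin m)) := fun n i =>
    {x | ∫ y, dist y (c i) ∂μ i + η < (∑ a, dist (x (i, a)) (c i)) / n}
  let B₃ : ∀ n, Fin k → Set (Fin k × Fin n → EuclideanSpace ℝ (Fin m)) := fun n i =>
    {x | ∫ y, -dist y (c i) ∂μ i + η < (∑ a, -dist (x (i, a)) (c i)) / n}
  let B₄ : ∀ n, (Σ i, N i × Fin k) → Set (Fin k × Fin n → EuclideanSpace ℝ (Fin m)) :=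
    fun n t => {x | ∫ y, max (α - dist t.2.1.1 y) 0 ∂μ t.2.2 + η
      < (∑ a, max (α - dist t.2.1.1 (x (t.2.2, a))) 0) / n}
  let B₅ : ∀ n, Fin k × Fin n → Set (Fin k × Fin n → EuclideanSpace ℝ (Fin m)) := fun n q =>
    {x | x q ∈ (Metric.closedBall (c q.1) 1)ᶜ}
  let B₆ : ∀ n, (Σ _ : Fin k, {t : Fin n × Fin n // t.1 ≠ t.2}) →
      Set (Fin k × Fin n → EuclideanSpace ℝ (Fin m)) := fun n t =>
    {x | ∑ b, dist (x (t.1, t.2.1.1)) (x (t.1, b)) = ∑ b, dist (x (t.1, t.2.1.2)) (x (t.1, b))}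
  have h₁ : Tendsto (fun n => sampleLaw n μ (⋃ i, B₁ n i)) atTop (𝓝 0) :=
    tendsto_measure_iUnion_zero fun i =>
      tendsto_sampleLaw_average_gt i (hfcoreL i) (half_pos (hcore i))
  have h₂ : Tendsto (fun n => sampleLaw n μ (⋃ i, B₂ n i)) atTop (𝓝 0) :=
    tendsto_measure_iUnion_zero fun i => tendsto_sampleLaw_average_gt i (hdistL i) hη
  have h₃ : Tendsto (fun n => sampleLaw n μ (⋃ i, B₃ n i)) atTop (𝓝 0) :=
    tendsto_measure_iUnion_zero fun i => tendsto_sampleLaw_average_gt i (hdistL i).neg hη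
  have h₄ : Tendsto (fun n => sampleLaw n μ (⋃ t, B₄ n t)) atTop (𝓝 0) :=
    tendsto_measure_iUnion_zero fun t => tendsto_sampleLaw_average_gt t.2.2 (hhingeL _ _) hη
  have h₅ : ∀ n, sampleLaw n μ (⋃ q, B₅ n q) = 0 := fun n => measure_iUnion_null fun q =>
    ((measurePreserving_eval (fun p : Fin k × Fin n => μ p.1) q).measure_preimage
      Metric.isClosed_closedBall.measurableSet.compl.nullMeasurableSet).trans (hμ q.1).2
  have h₆ : ∀ n, 3 ≤ n → sampleLaw n μ (⋃ t, B₆ n t) = 0 := fun n hn =>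
    measure_iUnion_null fun t => sampleLaw_sum_dist_eq_null hm hac hn t.1 t.2.2
  refine withHighProbability_of_tendsto_compl (tendsto_of_tendsto_of_tendsto_of_le_of_le'
    tendsto_const_nhds (h := fun n => sampleLaw n μ (⋃ i, B₁ n i) + sampleLaw n μ (⋃ i, B₂ n i)
      + sampleLaw n μ (⋃ i, B₃ n i) + sampleLaw n μ (⋃ t, B₄ n t))
    (by simpa using ((h₁.add h₂).add h₃).add h₄) (Eventually.of_forall fun _ => zero_le)
    ((eventually_ge_atTop 3).mono fun n hn => ?_))
  have hn0 : (0 : ℝ) < n := by exact_mod_cast (by omega : 0 < n)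
  suffices hsub : {x : Fin k × Fin n → EuclideanSpace ℝ (Fin m) | ExactRecovery k Prod.fst x}ᶜ ⊆
      (⋃ i, B₁ n i) ∪ (⋃ i, B₂ n i) ∪ (⋃ i, B₃ n i) ∪ (⋃ t, B₄ n t) ∪ (⋃ q, B₅ n q)
        ∪ (⋃ t, B₆ n t) by
    calc _ ≤ _ := measure_mono hsub
      _ ≤ sampleLaw n μ ((⋃ i, B₁ n i) ∪ (⋃ i, B₂ n i) ∪ (⋃ i, B₃ n i) ∪ (⋃ t, B₄ n t))
          + sampleLaw n μ (⋃ q, B₅ n q) + sampleLaw n μ (⋃ t, B₆ n t) :=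
          (measure_union_le _ _).trans (by gcongr; exact measure_union_le _ _)
      _ ≤ _ := by
          rw [h₅, h₆ n hn, add_zero, add_zero]
          refine (measure_union_le _ _).trans ?_
          gcongr
          refine (measure_union_le _ _).trans ?_
          gcongr
          exact measure_union_le _ _
  rw [Set.compl_subset_comm]
  intro x hx
  simp only [Set.mem_compl_iff, Set.mem_union, Set.mem_iUnion, not_or, not_exists] at hx
  obtain ⟨⟨⟨⟨⟨hx₁, hx₂⟩, hx₃⟩, hx₄⟩, hx₅⟩, hx₆⟩ := hx
  refine exactRecovery_of_typical (E := E) (by omega) hη hηρ hηγ hα hsep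
    (fun i a => not_not.1 (hx₅ (i, a))) ?_ ?_ ?_ ?_
    (fun i a a' ha => hx₆ ⟨i, (a, a'), ha⟩)
  · intro i
    by_contra! hfar
    refine hx₁ i ?_
    change ∫ y, fcore i y ∂μ i + (μ i).real (Metric.ball (c i) η) / 2
      < (∑ a, fcore i (x (i, a))) / n
    have h0 : ∀ a, fcore i (x (i, a)) = 0 := fun a =>
      Set.indicator_of_notMem (fun h => (hfar a).not_gt (Metric.mem_ball.1 h)) _
    simp only [h0, Finset.sum_const_zero, zero_div, hfcoreI]
    linarith [hcore i]
  · intro i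
    have h : (∑ a, dist (x (i, a)) (c i)) / n ≤ ∫ y, dist y (c i) ∂μ i + η := not_lt.1 (hx₂ i)
    rwa [div_le_iff₀ hn0, hE, mul_comm] at h
  · intro i
    have h : (∑ a, -dist (x (i, a)) (c i)) / n ≤ ∫ y, -dist y (c i) ∂μ i + η := not_lt.1 (hx₃ i)
    rw [div_le_iff₀ hn0, integral_neg, hE, Finset.sum_neg_distrib] at h
    linarith
  · intro i p hp1 hp
    obtain ⟨p', hp', hd⟩ := hNcov i p hp1 hp
    have hs := hslack i p' (hN i p' hp').1 (hN i p' hp').2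
    calc ∑ j, ∑ b, max (α - dist p (x (j, b))) 0
        ≤ ∑ j, ∑ b, (max (α - dist p' (x (j, b))) 0 + η) := by
          refine Finset.sum_le_sum fun j _ => Finset.sum_le_sum fun b _ => ?_
          have h1 := le_max_left (α - dist p' (x (j, b))) 0
          have h2 := le_max_right (α - dist p' (x (j, b))) 0
          have h3 := dist_triangle_left p' (x (j, b)) p
          exact max_le (by linarith) (by linarith)
      _ ≤ ∑ j, (n * (∫ y, max (α - dist p' y) 0 ∂μ j + η) + n * η) := by
          refine Finset.sum_le_sum fun j _ => ?_
          have h : (∑ a, max (α - dist p' (x (j, a))) 0) / n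
              ≤ ∫ y, max (α - dist p' y) 0 ∂μ j + η := not_lt.1 (hx₄ ⟨i, ⟨p', hp'⟩, j⟩)
          rw [div_le_iff₀ hn0] at h
          rw [Finset.sum_add_distrib, Finset.sum_const, Finset.card_univ, Fintype.card_fin,
            nsmul_eq_mul]
          linarith
      _ = n * (∑ j, ∫ y, max (α - dist p' y) 0 ∂μ j + 2 * k * η) := by
          simp only [Finset.sum_add_distrib, ← Finset.mul_sum, Finset.sum_const, Finset.card_univ,
            Fintype.card_fin, nsmul_eq_mul]
          ring
      _ ≤ n * (α - E - γ + 2 * k * η) := by gcongr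

end Sample
end KMedian

theorem mainTheorem5 :
    ∃ C : ℝ, 0 < C ∧
      ∀ (k m : ℕ), 1 ≤ k → 2 ≤ m →
      ∀ (c : Fin k → EuclideanSpace ℝ (Fin m)) (μ : Fin k → Measure (EuclideanSpace ℝ (Fin m))),
        (∀ i, KMedian.IsProbabilityOnBall (μ i) (c i) 1) →
        (∀ i, KMedian.RotationInvariant (μ i) (c i)) →
        (∀ i, KMedian.PositiveNearCenter (μ i) (c i) 1) →
        (∀ i, KMedian.NullOnLebesgueNull (μ i) (c i) 1) →
        (∀ i j, ∫ x, dist x (c i) ∂(μ i) = ∫ x, dist x (c j) ∂(μ j)) →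
        (∀ i j, i ≠ j → 2 + C * Real.sqrt (k * Real.log m / m) < dist (c i) (c j)) →
        KMedian.WithHighProbability (fun n => KMedian.sampleLaw n μ)
          (fun n => {x : Fin k × Fin n → EuclideanSpace ℝ (Fin m) |
            KMedian.ExactRecovery k Prod.fst x}) := by
  -- `200 ^ 2 * log 2 ≥ 27000`
  refine ⟨200, by norm_num, fun k m hk hm c μ hμ hrot hpos hnull hE hsep => ?_⟩
  have hac : ∀ i, μ i ≪ volume := fun i => (hnull i).absolutelyContinuous (hμ i)
  have hk0 : (1 : ℝ) ≤ k := by exact_mod_cast hk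
  have hm2 : (2 : ℝ) ≤ m := by exact_mod_cast hm
  have hlog : 0.69 ≤ Real.log m :=
    le_trans (by linarith [Real.log_two_gt_d9]) (Real.log_le_log two_pos hm2)
  set ε := 200 * Real.sqrt (k * Real.log m / m) with hε
  have hq : 0 < k * Real.log m / m := by
    have : 0 < Real.log m := by linarith
    positivity
  have hε0 : 0 < ε := by positivity
  have hε2 : ε ^ 2 * m = 40000 * (k * Real.log m) := by
    rw [hε, mul_pow, Real.sq_sqrt hq.le]
    field_simp
    norm_num
  have hE' : ∀ i, ∫ x, dist x (c i) ∂μ i = ∫ x, dist x (c ⟨0, hk⟩) ∂μ ⟨0, hk⟩ := fun i => hE _ _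
  rcases le_or_gt ε 2 with h2 | h2
  · obtain ⟨γ, hγ, hslack⟩ := KMedian.exists_slack_of_high_dim hm hμ hrot hε0 h2
      (by rw [hε2]; nlinarith) hsep
    refine KMedian.withHighProbability_of_slack (α := 1 + ε / 2) (ρ := ε / 8) hm hμ hpos hac hE'
      (by positivity) hγ (by linarith) (fun i j hij => ?_) fun i p h1 h3 => ?_
    · linarith [hsep i j hij]
    · rw [← hE' i]; exact hslack i p h1 h3
  · have hsep4 : ∀ i j, i ≠ j → 4 < dist (c i) (c j) := fun i j hij => by
      linarith [hsep i j hij]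
    obtain ⟨γ, hγ, hslack⟩ := KMedian.exists_slack_of_far_apart hm hμ hrot hac hsep4
      (ρ := 1 / 4) (by norm_num)
    refine KMedian.withHighProbability_of_slack (α := 2) (ρ := 1 / 4) hm hμ hpos hac hE'
      (by norm_num) hγ (by norm_num) (fun i j hij => ?_) fun i p h1 h3 => ?_
    · linarith [hsep4 i j hij]
    · rw [← hE' i]; exact hslack i p h1 h3
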